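/- For an integer $k\ge 1$ let $\eta(k)=\sum_{n\ge1}\frac{(-1)^{n-1}}{n^k}$ be the Dirichlet eta function, and let $\zeta$ be the Riemann zeta function. Then $$\zeta(3)=\frac{2}{7}\pi^2\Bigl(\frac14+\sum_{j=1}^{\infty}\frac{1}{(2j+1)(2j+2)}\,\eta(2j)\Bigr) =\frac{2}{7}\pi^2\Bigl(\frac38+\sum_{j=1}^{\infty}\frac{2j+3}{2^{2j+1}(2j+1)(2j+2)}\,\eta(2j)\Bigr),$$ where both series converge. The second series converges rapidly: with $$S_N=\frac{2}{7}\pi^2\Bigl(\frac38+\sum_{j=1}^{N}\frac{2j+3}{2^{2j+1}(2j+1)(2j+2)}\,\eta(2j)\Bigr),$$ one has $|\zeta(3)-S_N|\le 4^{-(N+1)}$ for every integer $N\ge 0$. Ten terms give $\zeta(3)$ to seven decimal places, $|\zeta(3)-S_{10}|<\frac12\cdot10^{-7}$, which is comparable to about $5000$ terms of the series $\sum_{j\ge 1} 1/j^3$: with $H_N=\sum_{j=1}^{N}1/j^3$, $$|\zeta(3)-H_{5050}|\le|\zeta(3)-S_{10}|\le|\zeta(3)-H_{5000}|.$$ -/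

import Mathlib

open scoped Real

/-- The Dirichlet eta function at the positive integer `k`:
`η(k) = ∑_{n ≥ 1} (-1)^(n-1) / n^k`, summed in the natural order, so that the conditionally
convergent case `k = 1` is included. (The value at `k = 0`, where the series diverges, is
irrelevant.) The summation index `n` below is shifted by one. -/
noncomputable def dirichletEta (k : ℕ) : ℝ :=
  ∑'[SummationFilter.conditional ℕ] n : ℕ, (-1 : ℝ) ^ n / ((n : ℝ) + 1) ^ k

/-- For `k ≥ 2` the series that defines `η(k)` converges absolutely, and its sum is `η(k)`. -/
theorem hasSum_dirichletEta {k : ℕ} (hk : 2 ≤ k) :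
    HasSum (fun n : ℕ => (-1 : ℝ) ^ n / ((n : ℝ) + 1) ^ k) (dirichletEta k) := by
  have h1 : Summable (fun n : ℕ => 1 / ((n : ℝ) + 1) ^ k) := by
    have h := (summable_nat_add_iff 1).2 (Real.summable_one_div_nat_pow.2 (by omega : 1 < k))
    simpa using h
  have h2 : Summable (fun n : ℕ => (-1 : ℝ) ^ n / ((n : ℝ) + 1) ^ k) := by
    refine Summable.of_norm_bounded h1 (fun n => ?_)
    rw [norm_div, norm_pow, norm_neg, norm_one, one_pow, Real.norm_of_nonneg (by positivity)]
  have h3 : HasSum (fun n : ℕ => (-1 : ℝ) ^ n / ((n : ℝ) + 1) ^ k)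
      (∑' n : ℕ, (-1 : ℝ) ^ n / ((n : ℝ) + 1) ^ k)
      (SummationFilter.conditional ℕ) := 
    h2.hasSum.mono_left SummationFilter.LeAtTop.le_atTop
  have h4 : dirichletEta k = ∑' n : ℕ, (-1 : ℝ) ^ n / ((n : ℝ) + 1) ^ k := h3.tsum_eq
  rw [h4]
  exact h2.hasSum

/-- The `j`-th term of the first series. -/
noncomputable def slowTerm (j : ℕ) : ℝ :=
  1 / ((2 * (j : ℝ) + 1) * (2 * (j : ℝ) + 2)) * dirichletEta (2 * j)

/-- The `j`-th term of the second, rapidly convergent series. -/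
noncomputable def rapidTerm (j : ℕ) : ℝ :=
  (2 * (j : ℝ) + 3) / (2 ^ (2 * j + 1) * (2 * (j : ℝ) + 1) * (2 * (j : ℝ) + 2)) *
    dirichletEta (2 * j)

/-- The approximation to `ζ(3)` given by the first `N` terms of the second series. -/
noncomputable def rapidApprox (N : ℕ) : ℝ :=
  2 / 7 * π ^ 2 * (3 / 8 + ∑ j ∈ Finset.Icc 1 N, rapidTerm j)

/-- The `N`-th partial sum of the defining series of `ζ(3)`. -/
noncomputable def zetaThreePartial (N : ℕ) : ℝ :=
  ∑ j ∈ Finset.Icc 1 N, 1 / (j : ℝ) ^ 3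

open Filter MeasureTheory Set Topology

/-! The partial fractions of the cotangent give the generating function
`∑_{j ≥ 1} η(2j) x ^ (2j) = (πx / sin πx - 1) / 2`. Multiplied by `1 - x` and integrated term by
term over `[0, 1]` it yields the first series of the theorem, and over `[0, 1 / 2]` the second: the
kernel `πx (1 - x) / sin πx` is symmetric about `1 / 2`, so its second integral is half of the
first, and the shorter interval gives the factor `4 ^ (-j)`.

The kernel integrates to `7 ζ(3) / π²` over `[0, 1]`: dividing the sine series
`x (1 - x) = 8 / π³ * ∑ sin ((2k + 1) πx) / (2k + 1) ^ 3` by `sin πx` leaves the quotients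
`sin ((2k + 1) πx) / sin πx`, each of which has integral `1`, and
`∑ 1 / (2k + 1) ^ 3 = 7 / 8 * ζ(3)`.

The errors of both approximations are sums of nonnegative terms. For the second series they are
compared with a geometric series, and for `∑ 1 / j ^ 3` with telescoping series. -/

/-! ### Zeta and eta at positive integers -/

/-- The sum `∑_{n ≥ 1} 1 / n ^ k` as a real number, with the index shifted by one: the real-valued
form of `riemannZeta k` for `2 ≤ k`, in which sums and integrals below are evaluated. -/
noncomputable def realZeta (k : ℕ) : ℝ := ∑' n : ℕ, 1 / ((n : ℝ) + 1) ^ k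

theorem hasSum_realZeta {k : ℕ} (hk : 2 ≤ k) :
    HasSum (fun n : ℕ => 1 / ((n : ℝ) + 1) ^ k) (realZeta k) := by
  have h := (summable_nat_add_iff 1).2 (Real.summable_one_div_nat_pow.2 hk)
  exact (h.congr fun n => by push_cast; rfl).hasSum

theorem riemannZeta_natCast_eq_realZeta {k : ℕ} (hk : 2 ≤ k) : riemannZeta k = realZeta k := by
  have hk' : 1 < (k : ℂ).re := by simpa using Nat.lt_of_succ_le hk
  rw [zeta_eq_tsum_one_div_nat_add_one_cpow hk', realZeta, Complex.ofReal_tsum]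
  refine tsum_congr fun n => ?_
  push_cast
  rw [Complex.cpow_natCast]

theorem hasSum_one_div_even_pow {k : ℕ} (hk : 2 ≤ k) :
    HasSum (fun n : ℕ => 1 / (2 * (n : ℝ) + 2) ^ k) (realZeta k / 2 ^ k) := by
  convert! (hasSum_realZeta hk).div_const (2 ^ k) using 2 with n
  rw [div_div, ← mul_pow]
  ring

theorem hasSum_one_div_odd_pow {k : ℕ} (hk : 2 ≤ k) :
    HasSum (fun n : ℕ => 1 / (2 * (n : ℝ) + 1) ^ k) ((1 - 1 / 2 ^ k) * realZeta k) := by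
  have h_odd : Summable (fun n : ℕ => 1 / (2 * (n : ℝ) + 1) ^ k) :=
    ((hasSum_realZeta hk).summable.comp_injective (mul_right_injective₀ (two_ne_zero' ℕ))).congr
      fun n => by simp
  have h_add := HasSum.even_add_odd (f := fun n : ℕ => 1 / ((n : ℝ) + 1) ^ k)
    (by simpa only [Nat.cast_mul, Nat.cast_ofNat] using h_odd.hasSum)
    (by simpa [add_assoc, one_add_one_eq_two] using hasSum_one_div_even_pow hk)
  convert! h_odd.hasSum using 1
  linear_combination (hasSum_realZeta hk).unique h_add

theorem dirichletEta_eq_realZeta {k : ℕ} (hk : 2 ≤ k) :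
    dirichletEta k = (1 - 2 / 2 ^ k) * realZeta k := by
  have h := HasSum.even_add_odd (f := fun n : ℕ => (-1 : ℝ) ^ n / ((n : ℝ) + 1) ^ k)
    (by simpa using hasSum_one_div_odd_pow hk)
    (by simpa [pow_succ, add_assoc, one_add_one_eq_two, neg_div]
      using (hasSum_one_div_even_pow hk).neg)
  rw [(hasSum_dirichletEta hk).unique h]
  ring

theorem antitone_one_div_succ_pow (k : ℕ) : Antitone fun n : ℕ => 1 / ((n : ℝ) + 1) ^ k := by
  intro m n hmn
  dsimp only
  gcongr

theorem tendsto_sum_dirichletEta {k : ℕ} (hk : 2 ≤ k) :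
    Tendsto (fun N => ∑ n ∈ Finset.range N, (-1 : ℝ) ^ n * (1 / ((n : ℝ) + 1) ^ k)) atTop
      (𝓝 (dirichletEta k)) := by
  simpa only [mul_one_div] using (hasSum_dirichletEta hk).tendsto_sum_nat

theorem dirichletEta_le_one {k : ℕ} (hk : 2 ≤ k) : dirichletEta k ≤ 1 := by
  simpa using
    (antitone_one_div_succ_pow k).tendsto_le_alternating_series (tendsto_sum_dirichletEta hk) 0

theorem one_sub_one_div_two_pow_le_dirichletEta {k : ℕ} (hk : 2 ≤ k) :
    1 - 1 / 2 ^ k ≤ dirichletEta k := by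
  have h :=
    (antitone_one_div_succ_pow k).alternating_series_le_tendsto (tendsto_sum_dirichletEta hk) 1
  convert! h using 1
  norm_num [Finset.sum_range_succ, sub_eq_add_neg]

theorem dirichletEta_nonneg {k : ℕ} (hk : 2 ≤ k) : 0 ≤ dirichletEta k := by
  refine le_trans ?_ (one_sub_one_div_two_pow_le_dirichletEta hk)
  rw [sub_nonneg, one_div]
  exact inv_le_one_of_one_le₀ (one_le_pow₀ one_le_two)

/-! ### The generating function of the values of eta at even integers -/

theorem hasSum_sq_div_sq_sub_sq {z : ℂ} (hz : z ∈ Complex.integerComplement) :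
    HasSum (fun n : ℕ => z ^ 2 / (((n : ℂ) + 1) ^ 2 - z ^ 2))
      ((1 - π * z * Complex.cot (π * z)) / 2) := by
  have hz0 : z ≠ 0 := Complex.integerComplement.ne_zero hz
  convert! (summable_cotTerm hz).hasSum.mul_left (-z / 2) using 1
  · funext n
    rw [cotTerm_identity hz, show ((n : ℂ) + 1) ^ 2 - z ^ 2 = -((z + (n + 1)) * (z - (n + 1))) by
      ring, div_neg]
    ring
  · rw [← cot_series_rep' hz]
    field_simp
    ring

theorem ofReal_mem_integerComplement_of_abs_lt_one {x : ℝ} (hx0 : x ≠ 0) (hx1 : |x| < 1) :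
    (x : ℂ) ∈ Complex.integerComplement := by
  rintro ⟨m, hm⟩
  obtain rfl : (m : ℝ) = x := by exact_mod_cast hm
  have hm1 : |m| < 1 := by exact_mod_cast hx1
  exact hx0 (by rw [Int.abs_lt_one_iff.1 hm1, Int.cast_zero])

theorem hasSum_pow_div_succ_pow {x : ℝ} (hx : |x| < 1) (n : ℕ) :
    HasSum (fun j : ℕ => 1 / ((n : ℝ) + 1) ^ (2 * j + 2) * x ^ (2 * j + 2))
      (x ^ 2 / (((n : ℝ) + 1) ^ 2 - x ^ 2)) := by
  have hxn : x ^ 2 < ((n : ℝ) + 1) ^ 2 :=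
    sq_lt_sq' (by linarith [(abs_lt.1 hx).1]) (by linarith [(abs_lt.1 hx).2])
  have hratio : (x / (n + 1)) ^ 2 < 1 := by rwa [div_pow, div_lt_one (by positivity)]
  convert! (hasSum_geometric_of_lt_one (sq_nonneg _) hratio).mul_left ((x / (n + 1)) ^ 2) using 1
  · funext j
    rw [← pow_mul, ← pow_add, div_pow]
    ring
  · have := sub_pos.2 hxn
    field_simp

theorem summable_pow_div_succ_pow {x : ℝ} (hx : |x| < 1) :
    Summable fun p : ℕ × ℕ => 1 / ((p.1 : ℝ) + 1) ^ (2 * p.2 + 2) * x ^ (2 * p.2 + 2) := by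
  refine Summable.of_nonneg_of_le
    (fun p => mul_nonneg (by positivity) (Even.pow_nonneg (by simp [parity_simps]) x)) (fun p => ?_)
    ((hasSum_realZeta le_rfl).summable.mul_of_nonneg
      (summable_geometric_of_lt_one (sq_nonneg x) ((sq_lt_one_iff_abs_lt_one x).2 hx))
      (fun n => by positivity) (fun j => by positivity))
  have hx2 : x ^ 2 ≤ 1 := ((sq_lt_one_iff_abs_lt_one x).2 hx).le
  rw [show x ^ (2 * p.2 + 2) = (x ^ 2) ^ (p.2 + 1) by rw [← pow_mul]; ring]
  gcongr ?_ * ?_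
  · gcongr <;> simp
  · exact pow_le_pow_of_le_one (sq_nonneg x) hx2 p.2.le_succ

theorem hasSum_realZeta_mul_pow {x : ℝ} (hx0 : x ≠ 0) (hx1 : |x| < 1) :
    HasSum (fun j : ℕ => realZeta (2 * j + 2) * x ^ (2 * j + 2))
      ((1 - π * x * Real.cot (π * x)) / 2) := by
  have h_cot : HasSum (fun n : ℕ => x ^ 2 / (((n : ℝ) + 1) ^ 2 - x ^ 2))
      ((1 - π * x * Real.cot (π * x)) / 2) := by
    have h := hasSum_sq_div_sq_sub_sq (ofReal_mem_integerComplement_of_abs_lt_one hx0 hx1)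
    exact Complex.hasSum_ofReal.1 (by simpa using h)
  have hf := summable_pow_div_succ_pow hx1
  have h_rows := hf.hasSum.prod_fiberwise (hasSum_pow_div_succ_pow hx1)
  have h_columns := hf.prod_symm.hasSum.prod_fiberwise
    fun j => (hasSum_realZeta (k := 2 * j + 2) (by lia)).mul_right (x ^ (2 * j + 2))
  convert! h_columns using 1
  exact (h_cot.unique h_rows).trans ((Equiv.prodComm ℕ ℕ).tsum_eq _).symm

theorem inv_sin_two_mul (t : ℝ) :
    (Real.sin (2 * t))⁻¹ = Real.cot t - Real.cot (2 * t) := by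
  rw [Real.cot_eq_cos_div_sin, Real.cot_eq_cos_div_sin, Real.sin_two_mul, Real.cos_two_mul]
  rcases eq_or_ne (Real.sin t) 0 with hs | hs
  · simp [hs]
  rcases eq_or_ne (Real.cos t) 0 with hc | hc
  · simp [hc]
  field_simp
  ring

theorem hasSum_dirichletEta_mul_pow {x : ℝ} (hx0 : x ≠ 0) (hx1 : |x| < 1) :
    HasSum (fun j : ℕ => dirichletEta (2 * j + 2) * x ^ (2 * j + 2))
      ((π * x / Real.sin (π * x) - 1) / 2) := by
  have hx1' : |x / 2| < 1 := by
    rw [abs_div, abs_two]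
    linarith [abs_nonneg x]
  convert! (hasSum_realZeta_mul_pow hx0 hx1).sub
    ((hasSum_realZeta_mul_pow (div_ne_zero hx0 two_ne_zero) hx1').mul_left 2) using 1
  · funext j
    rw [dirichletEta_eq_realZeta (by lia), div_pow]
    ring
  · have h := inv_sin_two_mul (π * (x / 2))
    rw [show 2 * (π * (x / 2)) = π * x by ring] at h
    rw [div_eq_mul_inv (π * x), h]
    ring

/-! ### The integral of the cosecant kernel -/

/-- The kernel `πx (1 - x) / sin (πx)` on `[0, 1]`, whose expansion in the functions
`(1 - x) x ^ (2j)` has the coefficient `2 η(2j)` for `j ≥ 1`. At the end points, where the limit is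
`1`, the division by zero gives the value `0`. -/
noncomputable def cscKernel (x : ℝ) : ℝ := π * x * (1 - x) / Real.sin (π * x)

theorem cscKernel_one_sub (x : ℝ) : cscKernel (1 - x) = cscKernel x := by
  rw [cscKernel, cscKernel, show π * (1 - x) = π - π * x by ring, Real.sin_pi_sub]
  ring

theorem sin_pi_mul_ne_zero_of_mem_Ioo {x : ℝ} (hx : x ∈ Ioo (0 : ℝ) 1) : Real.sin (π * x) ≠ 0 :=
  (Real.sin_pos_of_pos_of_lt_pi (mul_pos Real.pi_pos hx.1)
    (mul_lt_of_lt_one_right Real.pi_pos hx.2)).ne'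

theorem sin_odd_mul_eq_sin_mul_sum_cos (k : ℕ) (t : ℝ) :
    Real.sin ((2 * k + 1) * t) =
      Real.sin t * (1 + 2 * ∑ m ∈ Finset.range k, Real.cos (2 * (m + 1) * t)) := by
  induction k with
  | zero => simp
  | succ k ih =>
    have h_add : Real.sin ((2 * (k + 1) + 1) * t) - Real.sin ((2 * k + 1) * t) =
        2 * Real.sin t * Real.cos (2 * (k + 1) * t) := by
      rw [Real.sin_sub_sin]
      ring_nf
    rw [Finset.sum_range_succ]
    push_cast
    linear_combination h_add + ih

theorem abs_sin_odd_mul_div_sin_le (k : ℕ) (t : ℝ) :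
    |Real.sin ((2 * k + 1) * t) / Real.sin t| ≤ 2 * k + 1 := by
  rcases eq_or_ne (Real.sin t) 0 with hs | hs
  · rw [hs, div_zero, abs_zero]
    positivity
  rw [sin_odd_mul_eq_sin_mul_sum_cos, mul_div_cancel_left₀ _ hs]
  have h_sum : |∑ m ∈ Finset.range k, Real.cos (2 * (m + 1) * t)| ≤ k := by
    refine (Finset.abs_sum_le_sum_abs _ _).trans ?_
    simpa using Finset.sum_le_card_nsmul (Finset.range k) _ 1 fun m _ => Real.abs_cos_le_one _
  rw [abs_le] at h_sum ⊢
  constructor <;> linarith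

theorem integral_cos_two_mul_nat_mul_pi (m : ℕ) :
    ∫ x in (0 : ℝ)..1, Real.cos (2 * (m + 1) * (π * x)) = 0 := by
  have hm : 2 * ((m : ℝ) + 1) * π ≠ 0 := by positivity
  have hsin : Real.sin (2 * ((m : ℝ) + 1) * π) = 0 := by
    simpa using Real.sin_nat_mul_pi (2 * (m + 1))
  simp only [← mul_assoc]
  rw [intervalIntegral.integral_comp_mul_left _ hm, integral_cos, mul_one, hsin]
  simp

theorem integral_sin_odd_mul_div_sin (k : ℕ) :
    ∫ x in (0 : ℝ)..1, Real.sin ((2 * k + 1) * (π * x)) / Real.sin (π * x) = 1 := by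
  calc ∫ x in (0 : ℝ)..1, Real.sin ((2 * k + 1) * (π * x)) / Real.sin (π * x)
      = ∫ x in (0 : ℝ)..1, (1 + 2 * ∑ m ∈ Finset.range k, Real.cos (2 * (m + 1) * (π * x))) := by
        simp only [intervalIntegral.integral_of_le zero_le_one, integral_Ioc_eq_integral_Ioo]
        refine setIntegral_congr_fun measurableSet_Ioo fun x hx => ?_
        rw [sin_odd_mul_eq_sin_mul_sum_cos,
          mul_div_cancel_left₀ _ (sin_pi_mul_ne_zero_of_mem_Ioo hx)]
    _ = 1 := by
        have h_cont : Continuous fun x : ℝ =>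
            2 * ∑ m ∈ Finset.range k, Real.cos (2 * (m + 1) * (π * x)) := by fun_prop
        have h_cos (m : ℕ) : Continuous fun x : ℝ => Real.cos (2 * (m + 1) * (π * x)) := by fun_prop
        rw [intervalIntegral.integral_add intervalIntegrable_const (h_cont.intervalIntegrable 0 1),
          intervalIntegral.integral_const_mul, intervalIntegral.integral_finsetSum
            fun m _ => (h_cos m).intervalIntegrable 0 1]
        simp [integral_cos_two_mul_nat_mul_pi]

theorem bernoulli_three_eval (x : ℝ) :
    ((Polynomial.bernoulli 3).map (algebraMap ℚ ℝ)).eval x = x * (x - 1 / 2) * (x - 1) := by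
  have h3 : bernoulli 3 = 0 := by
    rw [bernoulli_eq_bernoulli'_of_ne_one (by decide), bernoulli'_three]
  simp only [Polynomial.bernoulli, Finset.sum_range_succ, Finset.sum_range_zero, bernoulli_zero,
    bernoulli_one, bernoulli_two, h3, Polynomial.map_add, Polynomial.map_monomial,
    Polynomial.eval_add, Polynomial.eval_monomial]
  norm_num [Nat.choose]
  ring

theorem hasSum_sin_two_pi_div_cube {x : ℝ} (hx : x ∈ Icc (0 : ℝ) 1) :
    HasSum (fun n : ℕ => Real.sin (2 * π * n * x) / n ^ 3)
      (2 * π ^ 3 / 3 * (x * (x - 1 / 2) * (x - 1))) := by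
  convert! hasSum_one_div_nat_pow_mul_sin one_ne_zero hx using 1
  · funext n
    ring
  · rw [show 2 * 1 + 1 = 3 from rfl, bernoulli_three_eval]
    simp only [Nat.factorial]
    push_cast
    ring

theorem hasSum_sin_odd_pi_div_cube {x : ℝ} (hx : x ∈ Icc (0 : ℝ) 1) :
    HasSum (fun k : ℕ => Real.sin ((2 * k + 1) * (π * x)) / (2 * k + 1) ^ 3)
      (π ^ 3 / 8 * (x * (1 - x))) := by
  -- In the Bernoulli series at `x / 2`, the even-indexed terms add up to an eighth of the series
  -- at `x`.
  have h_all := hasSum_sin_two_pi_div_cube (x := x / 2) ⟨by linarith [hx.1], by linarith [hx.2]⟩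
  have h_even : HasSum (fun k : ℕ => Real.sin (2 * π * (2 * k : ℕ) * (x / 2)) / (2 * k : ℕ) ^ 3)
      (1 / 8 * (2 * π ^ 3 / 3 * (x * (x - 1 / 2) * (x - 1)))) := by
    convert! (hasSum_sin_two_pi_div_cube hx).mul_left (1 / 8) using 2 with k
    push_cast
    rw [show 2 * π * (2 * k) * (x / 2) = 2 * π * k * x by ring]
    ring
  have h_odd : Summable fun k : ℕ =>
      Real.sin (2 * π * (2 * k + 1 : ℕ) * (x / 2)) / (2 * k + 1 : ℕ) ^ 3 :=
    h_all.summable.comp_injective (i := fun k : ℕ => 2 * k + 1) fun a b hab => by simpa using hab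
  have h_split := (HasSum.even_add_odd
    (f := fun n : ℕ => Real.sin (2 * π * n * (x / 2)) / n ^ 3) h_even h_odd.hasSum).unique h_all
  convert! h_odd.hasSum using 1
  · funext k
    push_cast
    rw [show 2 * π * (2 * k + 1) * (x / 2) = (2 * k + 1) * (π * x) by ring]
  · linear_combination -h_split

theorem hasSum_cscKernel {x : ℝ} (hx : x ∈ Icc (0 : ℝ) 1) :
    HasSum (fun k : ℕ => 8 / π ^ 2 * (1 / (2 * k + 1) ^ 3 *
      (Real.sin ((2 * k + 1) * (π * x)) / Real.sin (π * x)))) (cscKernel x) := by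
  convert! (hasSum_sin_odd_pi_div_cube hx).mul_left (8 / π ^ 2 / Real.sin (π * x)) using 1
  · funext k
    ring
  · rw [cscKernel]
    field_simp

theorem abs_cscKernel_term_le (k : ℕ) (x : ℝ) :
    |8 / π ^ 2 * (1 / (2 * k + 1) ^ 3 * (Real.sin ((2 * k + 1) * (π * x)) / Real.sin (π * x)))| ≤
      8 / π ^ 2 * (1 / (2 * k + 1) ^ 2) := by
  rw [abs_mul, abs_mul, abs_of_pos (by positivity), abs_of_pos (by positivity)]
  have h := abs_sin_odd_mul_div_sin_le k (π * x)
  calc 8 / π ^ 2 * (1 / (2 * (k : ℝ) + 1) ^ 3 *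
        |Real.sin ((2 * k + 1) * (π * x)) / Real.sin (π * x)|)
      ≤ 8 / π ^ 2 * (1 / (2 * (k : ℝ) + 1) ^ 3 * (2 * k + 1)) := by gcongr
    _ = 8 / π ^ 2 * (1 / (2 * k + 1) ^ 2) := by field_simp

theorem summable_cscKernel_bound : Summable fun k : ℕ => 8 / π ^ 2 * (1 / (2 * (k : ℝ) + 1) ^ 2) :=
  (hasSum_one_div_odd_pow le_rfl).summable.mul_left _

theorem measurable_cscKernel : Measurable cscKernel := by
  unfold cscKernel
  fun_prop

theorem intervalIntegrable_cscKernel : IntervalIntegrable cscKernel volume 0 1 := by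
  rw [intervalIntegrable_iff_integrableOn_Ioc_of_le zero_le_one]
  refine Measure.integrableOn_of_bounded (by simp)
    (M := ∑' k : ℕ, 8 / π ^ 2 * (1 / (2 * (k : ℝ) + 1) ^ 2))
    measurable_cscKernel.aestronglyMeasurable ?_
  filter_upwards [ae_restrict_mem measurableSet_Ioc] with x hx
  exact (hasSum_cscKernel (Ioc_subset_Icc_self hx)).norm_le_of_bounded
    summable_cscKernel_bound.hasSum fun k => abs_cscKernel_term_le k x

theorem integral_cscKernel : ∫ x in (0 : ℝ)..1, cscKernel x = 7 / π ^ 2 * realZeta 3 := by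
  have h_termwise := intervalIntegral.hasSum_integral_of_dominated_convergence (μ := volume)
    (a := 0) (b := 1)
    (F := fun (k : ℕ) x => 8 / π ^ 2 * (1 / (2 * k + 1) ^ 3 *
      (Real.sin ((2 * k + 1) * (π * x)) / Real.sin (π * x))))
    (fun (k : ℕ) _ => 8 / π ^ 2 * (1 / (2 * (k : ℝ) + 1) ^ 2))
    (fun k => Measurable.aestronglyMeasurable (by fun_prop))
    (fun k => ae_of_all _ fun x _ => abs_cscKernel_term_le k x)
    (ae_of_all _ fun _ _ => summable_cscKernel_bound) intervalIntegrable_const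
    (ae_of_all _ fun x hx => hasSum_cscKernel (by
      rw [uIoc_of_le zero_le_one] at hx
      exact Ioc_subset_Icc_self hx))
  simp only [intervalIntegral.integral_const_mul, integral_sin_odd_mul_div_sin, mul_one]
    at h_termwise
  rw [h_termwise.unique ((hasSum_one_div_odd_pow (k := 3) (by norm_num)).mul_left (8 / π ^ 2))]
  ring

theorem intervalIntegral_eq_two_smul_of_comp_sub {E : Type*} [NormedAddCommGroup E]
    [NormedSpace ℝ E] {f : ℝ → E} {a b : ℝ} (hf : IntervalIntegrable f volume a b)
    (hsymm : ∀ x, f (a + b - x) = f x) :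
    ∫ x in a..b, f x = (2 : ℝ) • ∫ x in a..((a + b) / 2), f x := by
  have h_mid : (a + b) / 2 ∈ uIcc a b := by
    rw [mem_uIcc]
    rcases le_total a b with h | h
    · exact .inl ⟨by linarith, by linarith⟩
    · exact .inr ⟨by linarith, by linarith⟩
  have h_reflect : ∫ x in ((a + b) / 2)..b, f x = ∫ x in a..((a + b) / 2), f x := by
    have h := intervalIntegral.integral_comp_sub_left (a := a) (b := (a + b) / 2) f (a + b)
    simp only [hsymm] at h
    rw [h, add_sub_cancel_left, sub_half]
  rw [← intervalIntegral.integral_add_adjacent_intervals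
    (hf.mono_set (uIcc_subset_uIcc_left h_mid)) (hf.mono_set (uIcc_subset_uIcc_right h_mid)),
    h_reflect, two_smul]

theorem integral_cscKernel_half :
    ∫ x in (0 : ℝ)..(1 / 2), cscKernel x = 7 / (2 * π ^ 2) * realZeta 3 := by
  have h := intervalIntegral_eq_two_smul_of_comp_sub intervalIntegrable_cscKernel
    fun x => by rw [zero_add, cscKernel_one_sub]
  rw [integral_cscKernel, zero_add, smul_eq_mul] at h
  linear_combination -h / 2

theorem hasSum_dirichletEta_mul_cscKernel {x : ℝ} (hx : x ∈ Ioc (0 : ℝ) 1) :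
    HasSum (fun j : ℕ => dirichletEta (2 * j + 2) * ((1 - x) * x ^ (2 * j + 2)))
      ((cscKernel x - (1 - x)) / 2) := by
  rcases hx.2.eq_or_lt with rfl | hx1
  · simp [cscKernel]
  · have hx1' : |x| < 1 := by rwa [abs_of_pos hx.1]
    convert! (hasSum_dirichletEta_mul_pow hx.1.ne' hx1').mul_left (1 - x) using 1
    · funext j
      ring
    · rw [cscKernel]
      ring

theorem integral_one_sub_mul_pow (b : ℝ) (m : ℕ) :
    ∫ x in (0 : ℝ)..b, (1 - x) * x ^ m = b ^ (m + 1) / (m + 1) - b ^ (m + 2) / (m + 2) := by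
  have h_expand (x : ℝ) : (1 - x) * x ^ m = x ^ m - x ^ (m + 1) := by ring
  simp only [h_expand]
  rw [intervalIntegral.integral_sub (by simp) (by simp), integral_pow, integral_pow]
  push_cast
  rw [zero_pow (by lia), zero_pow (by lia)]
  ring

theorem hasSum_dirichletEta_mul_integral {b : ℝ} (hb0 : 0 ≤ b) (hb1 : b ≤ 1) :
    HasSum (fun j : ℕ => dirichletEta (2 * j + 2) *
      (b ^ (2 * j + 3) / (2 * j + 3) - b ^ (2 * j + 4) / (2 * j + 4)))
      (((∫ x in (0 : ℝ)..b, cscKernel x) - (b - b ^ 2 / 2)) / 2) := by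
  have h_mem {x : ℝ} (hx : x ∈ uIoc 0 b) : x ∈ Ioc (0 : ℝ) 1 := by
    rw [uIoc_of_le hb0] at hx
    exact ⟨hx.1, hx.2.trans hb1⟩
  have h_int : IntervalIntegrable cscKernel volume 0 b :=
    intervalIntegrable_cscKernel.mono_set
      (by rw [uIcc_of_le hb0, uIcc_of_le zero_le_one]; exact Icc_subset_Icc_right hb1)
  have h_lin : IntervalIntegrable (fun x : ℝ => 1 - x) volume 0 b :=
    (by fun_prop : Continuous fun x : ℝ => 1 - x).intervalIntegrable 0 b
  have h_nonneg (j : ℕ) {x : ℝ} (hx : x ∈ uIoc 0 b) :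
      0 ≤ dirichletEta (2 * j + 2) * ((1 - x) * x ^ (2 * j + 2)) :=
    mul_nonneg (dirichletEta_nonneg (by lia))
      (mul_nonneg (sub_nonneg.2 (h_mem hx).2) (pow_nonneg (h_mem hx).1.le _))
  -- The terms are nonnegative, so the series dominates itself.
  have h_termwise := intervalIntegral.hasSum_integral_of_dominated_convergence (μ := volume)
    (fun j x => dirichletEta (2 * j + 2) * ((1 - x) * x ^ (2 * j + 2)))
    (fun j => by fun_prop)
    (fun j => ae_of_all _ fun x hx => (Real.norm_of_nonneg (h_nonneg j hx)).le)
    (ae_of_all _ fun x hx => (hasSum_dirichletEta_mul_cscKernel (h_mem hx)).summable)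
    (((h_int.sub h_lin).div_const 2).congr fun x hx =>
      (hasSum_dirichletEta_mul_cscKernel (h_mem hx)).tsum_eq.symm)
    (ae_of_all _ fun x hx => hasSum_dirichletEta_mul_cscKernel (h_mem hx))
  convert! h_termwise using 1
  · funext j
    rw [intervalIntegral.integral_const_mul, integral_one_sub_mul_pow]
    push_cast
    ring
  · have h_zero := integral_one_sub_mul_pow b 0
    norm_num at h_zero
    rw [intervalIntegral.integral_div, intervalIntegral.integral_sub h_int h_lin]
    simp [h_zero]

/-! ### The two series for `ζ(3)` -/

theorem slowTerm_succ (j : ℕ) :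
    slowTerm (j + 1) = dirichletEta (2 * j + 2) *
      ((1 : ℝ) ^ (2 * j + 3) / (2 * j + 3) - (1 : ℝ) ^ (2 * j + 4) / (2 * j + 4)) := by
  rw [slowTerm, mul_add_one, one_pow, one_pow]
  push_cast
  field_simp
  ring

theorem rapidTerm_succ (j : ℕ) :
    rapidTerm (j + 1) = 2 * (dirichletEta (2 * j + 2) *
      ((1 / 2 : ℝ) ^ (2 * j + 3) / (2 * j + 3) - (1 / 2 : ℝ) ^ (2 * j + 4) / (2 * j + 4))) := by
  rw [rapidTerm, show 2 * (j + 1) = 2 * j + 2 from rfl, one_div_pow, one_div_pow]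
  push_cast
  field_simp
  ring

theorem hasSum_slowTerm_succ :
    HasSum (fun j : ℕ => slowTerm (j + 1)) (7 / (2 * π ^ 2) * realZeta 3 - 1 / 4) := by
  simp only [slowTerm_succ]
  convert! hasSum_dirichletEta_mul_integral zero_le_one le_rfl using 1
  rw [integral_cscKernel]
  ring

theorem hasSum_rapidTerm_succ :
    HasSum (fun j : ℕ => rapidTerm (j + 1)) (7 / (2 * π ^ 2) * realZeta 3 - 3 / 8) := by
  simp only [rapidTerm_succ]
  convert! (hasSum_dirichletEta_mul_integral one_half_pos.le one_half_lt_one.le).mul_left 2 using 1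
  rw [integral_cscKernel_half]
  ring

/-! ### The error of the rapid series -/

theorem hasSum_tail_of_hasSum_succ {G : Type*} [AddCommGroup G] [TopologicalSpace G]
    [IsTopologicalAddGroup G] {f : ℕ → G} {s : G} (h : HasSum (fun j => f (j + 1)) s) (N : ℕ) :
    HasSum (fun j => f (j + N + 1)) (s - ∑ j ∈ Finset.Icc 1 N, f j) := by
  have h_sum : ∑ j ∈ Finset.Icc 1 N, f j = ∑ j ∈ Finset.range N, f (j + 1) := by
    rw [Finset.range_eq_Ico, Finset.sum_Ico_add' f 0 N 1]
    rfl
  rw [h_sum]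
  exact (hasSum_nat_add_iff' N).2 h

theorem hasSum_realZeta_three_sub_rapidApprox (N : ℕ) :
    HasSum (fun j : ℕ => 2 / 7 * π ^ 2 * rapidTerm (j + N + 1)) (realZeta 3 - rapidApprox N) := by
  convert! (hasSum_tail_of_hasSum_succ hasSum_rapidTerm_succ N).mul_left (2 / 7 * π ^ 2) using 1
  rw [rapidApprox]
  field_simp
  ring

/-- The rational factor of `rapidTerm j` left after splitting off `(1 / 4) ^ j` and `η(2j)`. -/
noncomputable def rapidWeight (j : ℕ) : ℝ :=
  (2 * (j : ℝ) + 3) / (2 * ((2 * (j : ℝ) + 1) * (2 * (j : ℝ) + 2)))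

theorem rapidTerm_eq_rapidWeight_mul (j : ℕ) :
    rapidTerm j = rapidWeight j * (1 / 4) ^ j * dirichletEta (2 * j) := by
  rw [rapidTerm, rapidWeight, pow_succ, pow_mul, show (2 : ℝ) ^ 2 = 4 by norm_num, one_div_pow]
  field_simp

theorem rapidWeight_nonneg (j : ℕ) : 0 ≤ rapidWeight j := by
  unfold rapidWeight
  positivity

theorem antitone_rapidWeight : Antitone rapidWeight := by
  have h_eq (j : ℕ) : rapidWeight j =
      1 / (2 * (2 * (j : ℝ) + 1)) + 1 / (4 * ((2 * (j : ℝ) + 1) * ((j : ℝ) + 1))) := by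
    rw [rapidWeight]
    field_simp
    ring
  intro i j hij
  rw [h_eq, h_eq]
  gcongr

theorem rapidTerm_nonneg {j : ℕ} (hj : 1 ≤ j) : 0 ≤ rapidTerm j := by
  rw [rapidTerm_eq_rapidWeight_mul]
  exact mul_nonneg (mul_nonneg (rapidWeight_nonneg j) (by positivity))
    (dirichletEta_nonneg (by lia))

theorem rapidTerm_le {j : ℕ} (hj : 1 ≤ j) : rapidTerm j ≤ rapidWeight j * (1 / 4) ^ j := by
  rw [rapidTerm_eq_rapidWeight_mul]
  exact mul_le_of_le_one_right (mul_nonneg (rapidWeight_nonneg j) (by positivity))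
    (dirichletEta_le_one (by lia))

theorem le_rapidTerm {j : ℕ} (hj : 1 ≤ j) :
    rapidWeight j * (1 / 4) ^ j * (1 - (1 / 4) ^ j) ≤ rapidTerm j := by
  have h := one_sub_one_div_two_pow_le_dirichletEta (k := 2 * j) (by lia)
  rw [pow_mul, ← one_div_pow, show ((2 : ℝ) ^ 2) = 4 by norm_num] at h
  rw [rapidTerm_eq_rapidWeight_mul]
  exact mul_le_mul_of_nonneg_left h (mul_nonneg (rapidWeight_nonneg j) (by positivity))

theorem rapidApprox_succ (N : ℕ) :
    rapidApprox (N + 1) = rapidApprox N + 2 / 7 * π ^ 2 * rapidTerm (N + 1) := by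
  rw [rapidApprox, rapidApprox, Finset.sum_Icc_succ_top (by lia)]
  ring

theorem rapidApprox_le_realZeta_three (N : ℕ) : rapidApprox N ≤ realZeta 3 :=
  sub_nonneg.1 <| (hasSum_realZeta_three_sub_rapidApprox N).nonneg fun _ =>
    mul_nonneg (by positivity) (rapidTerm_nonneg (by lia))

theorem realZeta_three_sub_rapidApprox_le (N : ℕ) :
    realZeta 3 - rapidApprox N ≤
      2 / 7 * π ^ 2 * (4 / 3 * rapidWeight (N + 1) * (1 / 4) ^ (N + 1)) := by
  have h_geom : HasSum (fun j : ℕ => rapidWeight (N + 1) * (1 / 4) ^ (j + N + 1))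
      (4 / 3 * rapidWeight (N + 1) * (1 / 4) ^ (N + 1)) := by
    convert! (hasSum_geometric_of_lt_one (r := (1 / 4 : ℝ)) (by norm_num) (by norm_num)).mul_left
      (rapidWeight (N + 1) * (1 / 4) ^ (N + 1)) using 1
    · funext j
      ring
    · norm_num
      ring
  refine hasSum_le (fun j => ?_) (hasSum_realZeta_three_sub_rapidApprox N)
    (h_geom.mul_left (2 / 7 * π ^ 2))
  gcongr
  calc rapidTerm (j + N + 1) ≤ rapidWeight (j + N + 1) * (1 / 4) ^ (j + N + 1) :=
        rapidTerm_le (by lia)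
    _ ≤ rapidWeight (N + 1) * (1 / 4) ^ (j + N + 1) := by
        gcongr
        exact antitone_rapidWeight (by lia)

theorem pi_sq_gt_d3 : 9.869 < π ^ 2 := by nlinarith [Real.pi_gt_d4]

theorem pi_sq_lt_d2 : π ^ 2 < 9.87 := by nlinarith [Real.pi_lt_d4, Real.pi_pos]

theorem realZeta_three_sub_rapidApprox_le_one_div_four_pow (N : ℕ) :
    realZeta 3 - rapidApprox N ≤ 1 / 4 ^ (N + 1) := by
  have h_weight : rapidWeight (N + 1) ≤ 5 / 24 :=
    (antitone_rapidWeight (by lia : 1 ≤ N + 1)).trans_eq (by norm_num [rapidWeight])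
  calc realZeta 3 - rapidApprox N
      ≤ 2 / 7 * π ^ 2 * (4 / 3 * rapidWeight (N + 1) * (1 / 4) ^ (N + 1)) :=
        realZeta_three_sub_rapidApprox_le N
    _ ≤ 2 / 7 * 9.87 * (4 / 3 * (5 / 24) * (1 / 4) ^ (N + 1)) := by
        have := rapidWeight_nonneg (N + 1)
        gcongr
        exact pi_sq_lt_d2.le
    _ ≤ 1 / 4 ^ (N + 1) := by
        rw [one_div_pow, ← mul_assoc]
        exact mul_le_of_le_one_left (by positivity) (by norm_num)

theorem realZeta_three_sub_rapidApprox_ten_le : realZeta 3 - rapidApprox 10 ≤ 1.99 / 10 ^ 8 := by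
  -- The general bound exceeds this by two per cent, so one more term is split off.
  have h_tail := realZeta_three_sub_rapidApprox_le 11
  rw [rapidApprox_succ] at h_tail
  have h_term := rapidTerm_le (j := 11) (by norm_num)
  calc realZeta 3 - rapidApprox 10
      ≤ 2 / 7 * π ^ 2 * (rapidWeight 11 * (1 / 4) ^ 11 +
          4 / 3 * rapidWeight 12 * (1 / 4) ^ 12) := by
        have := mul_le_mul_of_nonneg_left h_term (by positivity : 0 ≤ 2 / 7 * π ^ 2)
        linarith
    _ ≤ 2 / 7 * 9.87 * (rapidWeight 11 * (1 / 4) ^ 11 +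
          4 / 3 * rapidWeight 12 * (1 / 4) ^ 12) := by
        have := rapidWeight_nonneg 11
        have := rapidWeight_nonneg 12
        gcongr
        exact pi_sq_lt_d2.le
    _ ≤ 1.99 / 10 ^ 8 := by norm_num [rapidWeight]

theorem le_realZeta_three_sub_rapidApprox_ten : 1.965 / 10 ^ 8 ≤ realZeta 3 - rapidApprox 10 := by
  have h_terms : 6.97 / 10 ^ 9 ≤
      rapidTerm 11 + rapidTerm 12 + rapidTerm 13 + rapidTerm 14 := by
    have h11 := le_rapidTerm (j := 11) (by norm_num)
    have h12 := le_rapidTerm (j := 12) (by norm_num)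
    have h13 := le_rapidTerm (j := 13) (by norm_num)
    have h14 := le_rapidTerm (j := 14) (by norm_num)
    norm_num [rapidWeight] at h11 h12 h13 h14
    linarith
  have h_approx := rapidApprox_le_realZeta_three 14
  simp only [rapidApprox_succ 13, rapidApprox_succ 12, rapidApprox_succ 11, rapidApprox_succ 10]
    at h_approx
  calc 1.965 / 10 ^ 8 ≤ 2 / 7 * 9.869 * (6.97 / 10 ^ 9) := by norm_num
    _ ≤ 2 / 7 * π ^ 2 * (rapidTerm 11 + rapidTerm 12 + rapidTerm 13 + rapidTerm 14) := by
        gcongr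
        exact pi_sq_gt_d3.le
    _ ≤ realZeta 3 - rapidApprox 10 := by linarith

/-! ### The error of the partial sums of `ζ(3)` -/

theorem hasSum_sub_succ_of_antitone {f : ℕ → ℝ} {c : ℝ} (hf : Antitone f)
    (hlim : Tendsto f atTop (𝓝 c)) : HasSum (fun n => f n - f (n + 1)) (f 0 - c) := by
  rw [hasSum_iff_tendsto_nat_of_nonneg fun n => sub_nonneg.2 (hf n.le_succ)]
  simp only [Finset.sum_range_sub']
  exact hlim.const_sub (f 0)

theorem hasSum_one_div_mul_add_one_mul_add_two {c : ℝ} (hc : 0 < c) :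
    HasSum (fun n : ℕ => 1 / ((n + c) * (n + c + 1) * (n + c + 2))) (1 / (2 * (c * (c + 1)))) := by
  have h_anti : Antitone fun n : ℕ => 1 / (2 * ((n + c) * (n + c + 1))) := fun m n hmn => by
    dsimp only
    gcongr
  have h_lim : Tendsto (fun n : ℕ => 1 / (2 * ((n + c) * (n + c + 1)))) atTop (𝓝 0) := by
    have h_atTop : Tendsto (fun n : ℕ => (n : ℝ) + c) atTop atTop :=
      tendsto_atTop_add_const_right _ c tendsto_natCast_atTop_atTop
    exact ((h_atTop.atTop_mul_atTop₀ (tendsto_atTop_add_const_right _ 1 h_atTop)).const_mul_atTop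
      two_pos).const_div_atTop 1
  convert! hasSum_sub_succ_of_antitone h_anti h_lim using 1
  · funext n
    push_cast
    field_simp
    ring
  · simp

theorem hasSum_realZeta_three_sub_zetaThreePartial (N : ℕ) :
    HasSum (fun n : ℕ => 1 / ((n : ℝ) + N + 1) ^ 3) (realZeta 3 - zetaThreePartial N) := by
  have h := hasSum_tail_of_hasSum_succ (f := fun j : ℕ => 1 / (j : ℝ) ^ 3)
    (by simpa only [Nat.cast_add, Nat.cast_one] using hasSum_realZeta (k := 3) (by norm_num)) N
  simpa only [zetaThreePartial, Nat.cast_add, Nat.cast_one] using h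

theorem le_realZeta_three_sub_zetaThreePartial (N : ℕ) :
    1 / (2 * ((N + 1) * (N + 2))) ≤ realZeta 3 - zetaThreePartial N := by
  have h := hasSum_one_div_mul_add_one_mul_add_two (c := N + 1) (by positivity)
  rw [show (N : ℝ) + 1 + 1 = N + 2 by ring] at h
  refine hasSum_le (fun n => ?_) h (hasSum_realZeta_three_sub_zetaThreePartial N)
  rw [← add_assoc]
  have hx : (0 : ℝ) < n + N + 1 := by positivity
  gcongr
  nlinarith [mul_pos hx hx]

theorem realZeta_three_sub_zetaThreePartial_le {N : ℕ} (hN : 0 < N) :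
    realZeta 3 - zetaThreePartial N ≤ 1 / (2 * (N * (N + 1))) := by
  refine hasSum_le (fun n => ?_) (hasSum_realZeta_three_sub_zetaThreePartial N)
    (hasSum_one_div_mul_add_one_mul_add_two (Nat.cast_pos.2 hN))
  have : (0 : ℝ) < n + N := by positivity
  gcongr
  nlinarith

theorem zetaThreePartial_le_realZeta_three (N : ℕ) : zetaThreePartial N ≤ realZeta 3 :=
  sub_nonneg.1 <| (by positivity : (0 : ℝ) ≤ 1 / (2 * ((N + 1) * (N + 2)))).trans
    (le_realZeta_three_sub_zetaThreePartial N)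

theorem riemannZeta_three_eq_realZeta : riemannZeta 3 = realZeta 3 := by
  exact_mod_cast riemannZeta_natCast_eq_realZeta (k := 3) (by norm_num)

theorem norm_riemannZeta_three_sub {a : ℝ} (ha : a ≤ realZeta 3) :
    ‖riemannZeta 3 - a‖ = realZeta 3 - a := by
  rw [riemannZeta_three_eq_realZeta, ← Complex.ofReal_sub, Complex.norm_real,
    Real.norm_of_nonneg (sub_nonneg.2 ha)]

theorem mainTheorem6 :
    -- first series, `j` running over the positive integers
    (Summable (fun j : ℕ+ => slowTerm j) ∧
      riemannZeta 3 = ((2 / 7 * π ^ 2 * (1 / 4 + ∑' j : ℕ+, slowTerm j) : ℝ) : ℂ)) ∧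
    -- second series
    (Summable (fun j : ℕ+ => rapidTerm j) ∧
      riemannZeta 3 = ((2 / 7 * π ^ 2 * (3 / 8 + ∑' j : ℕ+, rapidTerm j) : ℝ) : ℂ)) ∧
    -- geometric convergence of the second series
    (∀ N : ℕ, ‖riemannZeta 3 - (rapidApprox N : ℂ)‖ ≤ 1 / 4 ^ (N + 1)) ∧
    -- ten terms of the second series are accurate to seven decimal places
    ‖riemannZeta 3 - (rapidApprox 10 : ℂ)‖ < 1 / 2 * (1 / 10 ^ 7) ∧
    -- and comparable to about 5000 terms of the defining series of `ζ(3)`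
    ‖riemannZeta 3 - (rapidApprox 10 : ℂ)‖ ≤ ‖riemannZeta 3 - (zetaThreePartial 5000 : ℂ)‖ ∧
    ‖riemannZeta 3 - (zetaThreePartial 5050 : ℂ)‖ ≤ ‖riemannZeta 3 - (rapidApprox 10 : ℂ)‖ := by
  have h_slow := hasSum_pnat_iff_hasSum_succ.2 hasSum_slowTerm_succ
  have h_rapid := hasSum_pnat_iff_hasSum_succ.2 hasSum_rapidTerm_succ
  have h_upper := realZeta_three_sub_rapidApprox_ten_le
  have h_lower := le_realZeta_three_sub_rapidApprox_ten
  simp only [fun N => norm_riemannZeta_three_sub (rapidApprox_le_realZeta_three N),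
    fun N => norm_riemannZeta_three_sub (zetaThreePartial_le_realZeta_three N)]
  refine ⟨⟨h_slow.summable, ?_⟩, ⟨h_rapid.summable, ?_⟩,
    realZeta_three_sub_rapidApprox_le_one_div_four_pow, h_upper.trans_lt (by norm_num), ?_, ?_⟩
  · rw [h_slow.tsum_eq, riemannZeta_three_eq_realZeta]
    congr 1
    field_simp
    ring
  · rw [h_rapid.tsum_eq, riemannZeta_three_eq_realZeta]
    congr 1
    field_simp
    ring
  · exact h_upper.trans (le_trans (by norm_num) (le_realZeta_three_sub_zetaThreePartial 5000))
  · exact (realZeta_three_sub_zetaThreePartial_le (by norm_num)).trans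
      (le_trans (by norm_num) h_lower)
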